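/- Let $(G_A,G_B)$ be a pair of real random variables with finitely many values, with joint law $p(g_A,g_B)$ known to both players. Below, "all $g_A$" and "all $g_B$" refer to values taken with positive probability. Assume $G_A\neq 1/2$ and $G_B\neq 1/2$ with probability $1$. Nature draws $(G_A,G_B)$ once; Alice learns only $G_A$ and Bob learns only $G_B$. Then $n\ge 1$ stages are played. At each stage Alice plays risky ($\mathsf R$) or non-risky ($\mathsf{NR}$). After $\mathsf{NR}$ Bob has no move and both players gain $1/2$. After $\mathsf R$ Bob chooses the left or the right piece: Alice and Bob gain $G_A,\,G_B$ respectively if he chooses left, and $1-G_A,\,1-G_B$ if he chooses right. Both players observe and recall all past actions. Strategies are behavioral, and each player's payoff is the expected sum of his or her gains over the $n$ stages. Let $T=0$ if $G_A>1/2>G_B$ or $G_A<1/2<G_B$, and $T=1$ otherwise. Put $g_A^{\min}=\min\{g_A,1-g_A\}$ and $g_A^{\max}=\max\{g_A,1-g_A\}$. Strategy $S_B$: whenever Alice has played $\mathsf R$, Bob takes the piece worth more to him (left if $G_B>1/2$, right if $G_B<1/2$). Strategy $S_A$: at stage $k$ Alice plays $\mathsf R$ if $n_g(k)\ge n_l(k)$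 and $\mathsf{NR}$ otherwise, where $n_g(k)$ and $n_l(k)$ are the numbers of stages $t<k$ at which her gain was $>1/2$ and $<1/2$ respectively. **Theorem.** Suppose that for all $g_A$ we have $p(T=0\mid G_A=g_A)\neq 0$, $p(T=1\mid G_A=g_A)\neq 0$ and $$p(T=0\mid G_A=g_A)\,g_A^{\min}+p(T=1\mid G_A=g_A)\,g_A^{\max}>\tfrac12 .$$ Then $(S_A,S_B)$ is 1. a Nash equilibrium of the $n$-stage game; 2. a trembling-hand-perfect equilibrium: some sequence of completely mixed behavioral strategy pairs converges to $(S_A,S_B)$ and is such that, for every member of the sequence and every information set, the action prescribed by $(S_A,S_B)$ there maximizes the expected payoff of the player moving there when that member is followed at all other information sets; 3. a sequential equilibrium: there are beliefs at all information sets such that (consistency) the strategies and beliefs are the limit of completely mixed strategy pairs and of the beliefs derived from them by Bayes' rule, and (sequential rationality) at every information set, given the beliefs there, the mover cannot increase his or her expected payoff by any change of his or her whole strategy. -/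

import Mathlib

open Filter Topology

noncomputable section

namespace DivideChoose

/-! ### The one-stage game -/

/-- Alice's actions at a stage. -/
inductive Cut where
  | risky
  | nonrisky
  deriving DecidableEq

instance : Fintype Cut := ⟨{.risky, .nonrisky}, fun x => by cases x <;> simp⟩

/-- Bob's actions at a stage at which Alice has played risky. -/
inductive Piece where
  | left
  | right
  deriving DecidableEq

instance : Fintype Piece := ⟨{.left, .right}, fun x => by cases x <;> simp⟩

/-- What is played (and publicly observed) at one stage. Bob has no move if Alice plays
non-risky. -/
inductive Outcome where
  | nonrisky
  | risky (c : Piece)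
  deriving DecidableEq

instance : Fintype Outcome :=
  ⟨{.nonrisky, .risky .left, .risky .right}, fun x => by
    rcases x with _ | c
    · simp
    · cases c <;> simp⟩

/-- Gain at one stage of a player (Alice or Bob) whose private valuation is `g`: `g` when Bob
chooses left, `1 - g` when Bob chooses right, `1 / 2` when Alice does not risk. -/
def gain (g : ℝ) : Outcome → ℝ
  | .nonrisky => 1 / 2
  | .risky .left => g
  | .risky .right => 1 - g

/-- The random variable `T` as a function of the values of `G_A` and `G_B`. -/
def matchType (gA gB : ℝ) : Fin 2 :=
  if (gA > 1 / 2 ∧ gB < 1 / 2) ∨ (gA < 1 / 2 ∧ gB > 1 / 2) then 0 else 1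

/-- A joint law of `(G_A, G_B)` with finitely many values. `suppA` and `suppB` are the sets of
values which `G_A` and `G_B` take with positive probability. -/
structure Prior where
  suppA : Finset ℝ
  suppB : Finset ℝ
  p : suppA → suppB → ℝ
  p_nonneg : ∀ a b, 0 ≤ p a b
  p_sum : ∑ a, ∑ b, p a b = 1
  margA_pos : ∀ a, 0 < ∑ b, p a b
  margB_pos : ∀ b, 0 < ∑ a, p a b

/-- The conditional probability `p(T = t | G_A = a)`. -/
def Prior.condT (P : Prior) (t : Fin 2) (a : P.suppA) : ℝ :=
  (∑ b : P.suppB, if matchType a b = t then P.p a b else 0) / ∑ b, P.p a b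

/-! ### The repeated game -/

/-- The outcomes of the completed stages, the most recent one first. -/
abbrev History := List Outcome

/-- Probability distributions on a finite set. -/
abbrev Lottery (α : Type) [Fintype α] := stdSimplex ℝ α

/-- The distribution concentrated at one point. -/
def sure {α : Type} [Fintype α] [DecidableEq α] (x : α) : Lottery α :=
  ⟨Pi.single x 1, single_mem_stdSimplex ℝ x⟩

/-- Behavioral strategies of Alice: `(σ a h).1 x` is the probability of `x` at her information
set given by `G_A = a` and the past `h`. The information sets of the `n`-stage game are those
with `h.length < n`; only these enter the definitions below. -/
abbrev AliceStrategy (P : Prior) := P.suppA → History → Lottery Cut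

/-- Behavioral strategies of Bob: `(τ b h).1 c` is the probability of `c` at his information
set given by `G_B = b`, the past `h`, and the fact that Alice plays risky at the current stage. -/
abbrev BobStrategy (P : Prior) := P.suppB → History → Lottery Piece

variable {P : Prior}

/-- Probability of the outcome of the stage after `h`. -/
def stageProb (σ : AliceStrategy P) (τ : BobStrategy P) (a : P.suppA) (b : P.suppB)
    (h : History) : Outcome → ℝ
  | .nonrisky => (σ a h).1 .nonrisky
  | .risky c => (σ a h).1 .risky * (τ b h).1 c

/-- Probability that the play goes through the history `h`, given the two valuations. -/
def reachProb (σ : AliceStrategy P) (τ : BobStrategy P) (a : P.suppA) (b : P.suppB) :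
    History → ℝ
  | [] => 1
  | o :: h => reachProb σ τ a b h * stageProb σ τ a b h o

/-- Total gain along a history of a player with valuation `g`. -/
def totalGain (g : ℝ) (h : History) : ℝ := (h.map (gain g)).sum

/-- Expected total gain at the end of the game of a player with valuation `g`, when the play has
reached the history `h` and `m` further stages remain. -/
def value (g : ℝ) (σ : AliceStrategy P) (τ : BobStrategy P) (a : P.suppA) (b : P.suppB) :
    ℕ → History → ℝ
  | 0, h => totalGain g h
  | m + 1, h => ∑ o : Outcome, stageProb σ τ a b h o * value g σ τ a b m (o :: h)

/-- The same at Bob's decision node after `h` at which Alice has just played risky and after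
which `m` further stages remain. -/
def valueAfterRisk (g : ℝ) (σ : AliceStrategy P) (τ : BobStrategy P) (a : P.suppA)
    (b : P.suppB) (m : ℕ) (h : History) : ℝ :=
  ∑ c : Piece, (τ b h).1 c * value g σ τ a b m (.risky c :: h)

/-- Alice's expected gain in the `n`-stage game. -/
def aliceGain (n : ℕ) (σ : AliceStrategy P) (τ : BobStrategy P) : ℝ :=
  ∑ a, ∑ b, P.p a b * value a σ τ a b n []

/-- Bob's expected gain in the `n`-stage game. -/
def bobGain (n : ℕ) (σ : AliceStrategy P) (τ : BobStrategy P) : ℝ :=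
  ∑ a, ∑ b, P.p a b * value b σ τ a b n []

/-! ### Equilibrium notions -/

/-- Nash equilibrium in behavioral strategies. -/
def IsNash (n : ℕ) (σ : AliceStrategy P) (τ : BobStrategy P) : Prop :=
  (∀ σ' : AliceStrategy P, aliceGain n σ' τ ≤ aliceGain n σ τ) ∧
  (∀ τ' : BobStrategy P, bobGain n σ τ' ≤ bobGain n σ τ)

/-- The strategy `s` with the distribution at the information set `(x, h)` replaced by `q`. -/
def changeAt {X L : Type} [DecidableEq X] (s : X → History → L) (x : X) (h : History) (q : L) :
    X → History → L :=
  fun y k => if y = x ∧ k = h then q else s y k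

/-- Every action has positive probability at every information set of the `n`-stage game. -/
def CompletelyMixed (n : ℕ) (σ : AliceStrategy P) (τ : BobStrategy P) : Prop :=
  (∀ a h, h.length < n → ∀ x, 0 < (σ a h).1 x) ∧
  (∀ b h, h.length < n → ∀ c, 0 < (τ b h).1 c)

/-- Convergence of strategy pairs at every information set of the `n`-stage game. -/
def ConvergesTo (n : ℕ) (σs : ℕ → AliceStrategy P) (τs : ℕ → BobStrategy P)
    (σ : AliceStrategy P) (τ : BobStrategy P) : Prop :=
  (∀ a h, h.length < n → Tendsto (fun i => σs i a h) atTop (𝓝 (σ a h))) ∧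
  (∀ b h, h.length < n → Tendsto (fun i => τs i b h) atTop (𝓝 (τ b h)))

/-- Trembling hand perfect equilibrium of the `n`-stage game, that is, of its agent strategic
form: each information set is a separate player, who has the gain of the player who moves there.
Some sequence of completely mixed profiles converges to `(σ, τ)`, and for each of its members
what `(σ, τ)` prescribes at an information set is a best response there when the member is
followed at all the other ones. -/
def IsTHP (n : ℕ) (σ : AliceStrategy P) (τ : BobStrategy P) : Prop :=
  ∃ (σs : ℕ → AliceStrategy P) (τs : ℕ → BobStrategy P),
    (∀ i, CompletelyMixed n (σs i) (τs i)) ∧ ConvergesTo n σs τs σ τ ∧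
    (∀ i a h, h.length < n → ∀ q : Lottery Cut,
      aliceGain n (changeAt (σs i) a h q) (τs i) ≤
        aliceGain n (changeAt (σs i) a h (σ a h)) (τs i)) ∧
    (∀ i b h, h.length < n → ∀ q : Lottery Piece,
      bobGain n (σs i) (changeAt (τs i) b h q) ≤
        bobGain n (σs i) (changeAt (τs i) b h (τ b h)))

/-- Alice's beliefs: at her information set `(a, h)` a distribution of `G_B`. -/
abbrev AliceBelief (P : Prior) := P.suppA → History → Lottery P.suppB

/-- Bob's beliefs: at his information set `(b, h)`, where Alice has just played risky, a
distribution of `G_A`. -/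
abbrev BobBelief (P : Prior) := P.suppB → History → Lottery P.suppA

/-- Bayes' rule at Alice's information set `(a, h)`. -/
def aliceBayes (σ : AliceStrategy P) (τ : BobStrategy P) (a : P.suppA) (h : History)
    (b : P.suppB) : ℝ :=
  P.p a b * reachProb σ τ a b h / ∑ b', P.p a b' * reachProb σ τ a b' h

/-- Bayes' rule at Bob's information set `(b, h)`. -/
def bobBayes (σ : AliceStrategy P) (τ : BobStrategy P) (b : P.suppB) (h : History)
    (a : P.suppA) : ℝ :=
  P.p a b * (reachProb σ τ a b h * (σ a h).1 .risky) /
    ∑ a', P.p a' b * (reachProb σ τ a' b h * (σ a' h).1 .risky)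

/-- Consistency of an assessment: it is a limit of completely mixed strategy pairs together with
the beliefs that follow from them by Bayes' rule. -/
def IsConsistent (n : ℕ) (σ : AliceStrategy P) (τ : BobStrategy P)
    (μA : AliceBelief P) (μB : BobBelief P) : Prop :=
  ∃ (σs : ℕ → AliceStrategy P) (τs : ℕ → BobStrategy P),
    (∀ i, CompletelyMixed n (σs i) (τs i)) ∧ ConvergesTo n σs τs σ τ ∧
    (∀ a h, h.length < n → ∀ b,
      Tendsto (fun i => aliceBayes (σs i) (τs i) a h b) atTop (𝓝 ((μA a h).1 b))) ∧
    (∀ b h, h.length < n → ∀ a,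
      Tendsto (fun i => bobBayes (σs i) (τs i) b h a) atTop (𝓝 ((μB b h).1 a)))

/-- Sequential rationality: at every information set, given the beliefs there, no change of the
whole strategy of the player who moves there increases his or her expected gain. -/
def IsSequentiallyRational (n : ℕ) (σ : AliceStrategy P) (τ : BobStrategy P)
    (μA : AliceBelief P) (μB : BobBelief P) : Prop :=
  (∀ a h, h.length < n → ∀ σ' : AliceStrategy P,
    ∑ b, (μA a h).1 b * value a σ' τ a b (n - h.length) h ≤
      ∑ b, (μA a h).1 b * value a σ τ a b (n - h.length) h) ∧
  (∀ b h, h.length < n → ∀ τ' : BobStrategy P,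
    ∑ a, (μB b h).1 a * valueAfterRisk b σ τ' a b (n - h.length - 1) h ≤
      ∑ a, (μB b h).1 a * valueAfterRisk b σ τ a b (n - h.length - 1) h)

/-- Sequential equilibrium: with suitable beliefs the strategies form a consistent and
sequentially rational assessment. -/
def IsSequentialEquilibrium (n : ℕ) (σ : AliceStrategy P) (τ : BobStrategy P) : Prop :=
  ∃ (μA : AliceBelief P) (μB : BobBelief P),
    IsConsistent n σ τ μA μB ∧ IsSequentiallyRational n σ τ μA μB

/-! ### The strategy pair -/

/-- The number of past stages at which Alice gained more than `1 / 2`. -/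
def successes (gA : ℝ) (h : History) : ℕ := h.countP (fun o => gain gA o > 1 / 2)

/-- The number of past stages at which Alice gained less than `1 / 2`. -/
def failures (gA : ℝ) (h : History) : ℕ := h.countP (fun o => gain gA o < 1 / 2)

/-- Alice risks if and only if she has at least as many past successes as past failures. -/
def aliceCounting (P : Prior) : AliceStrategy P :=
  fun a h => sure (if failures a h ≤ successes a h then Cut.risky else Cut.nonrisky)

/-- Bob always takes the piece which is worth more to him. -/
def bobSelfish (P : Prior) : BobStrategy P :=
  fun b _ => sure (if (b : ℝ) > 1 / 2 then Piece.left else Piece.right)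

end DivideChoose

end

/-! Centred at 1/2, a stage gain of a player with valuation g is `|g - 1/2|` times 1, -1 or 0, so
each player wants to maximize an integer `balance`: choices of the preferred piece minus choices of
the other. Both strategies, and their trembling versions with mistake probability e, depend only on
balances, so expected payoffs reduce to the one-dimensional recursion `drift`.

Bob: when Alice's risk probability is a function of the balance, the expected final balance is
increasing in the current one (`drift_mono`). Taking his preferred piece is therefore optimal
against each value of `G_A` separately, whatever he believes, with or without trembles.

Alice: the inequality on the prior says that agreement with Bob is more likely than disagreement
(`disagree_lt_agree`). Against selfish Bob one risk reveals which case holds: under agreement every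
risk gains one unit, under disagreement every risk loses one. At balance 0 the best trade-off is to
lose at most one unit under disagreement and win every stage under agreement, which is what counting
achieves (`alice_sum_value_le`).

Off the path, Alice's beliefs come from the trembles: pairs of one success and one failure carry no
information, and as e tends to 0 the surplus of successes or failures decides. Positive balance
means certain agreement, negative balance certain disagreement, balance 0 the prior (`weight_zero`).
For these limit weights her global optimality gives Nash and sequential rationality. For perfection,
her local incentive `totalEdge` is continuous in e and strictly of the right sign at e = 0; as there
are finitely many information sets, the sign persists for all small e. -/

namespace DivideChoose

variable {P : Prior}

/-! ### Pieces, balances and gains -/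

/-- The piece which is worth more to a player with valuation `g ≠ 1 / 2`. -/
noncomputable def preferred (g : ℝ) : Piece := if g > 1 / 2 then .left else .right

/-- The piece other than `c`. -/
noncomputable def Piece.other : Piece → Piece
  | .left => .right
  | .right => .left

/-- The contribution of an outcome to the balance in favour of `c`. -/
noncomputable def sign (c : Piece) : Outcome → ℤ
  | .nonrisky => 0
  | .risky c' => if c' = c then 1 else -1

/-- The number of times `c` was chosen minus the number of times the other piece was chosen. -/
noncomputable def balance (c : Piece) : History → ℤ
  | [] => 0
  | o :: h => balance c h + sign c o

@[simp] lemma balance_nil (c : Piece) : balance c [] = 0 := rfl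

@[simp] lemma balance_nonrisky (c : Piece) (h : History) :
    balance c (.nonrisky :: h) = balance c h := by simp [balance, sign]

@[simp] lemma balance_self (c : Piece) (h : History) :
    balance c (.risky c :: h) = balance c h + 1 := by simp [balance, sign]

@[simp] lemma balance_other (c : Piece) (h : History) :
    balance c (.risky c.other :: h) = balance c h - 1 := by
  cases c <;> simp [balance, sign, Piece.other, sub_eq_add_neg]

lemma Piece.eq_other_of_ne {c d : Piece} (hcd : d ≠ c) : d = c.other := by
  cases c <;> cases d <;> simp_all [Piece.other]

lemma Piece.other_ne (c : Piece) : c.other ≠ c := by cases c <;> simp [Piece.other]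

lemma balance_other_left (c : Piece) (h : History) : balance c.other h = -balance c h := by
  induction h with
  | nil => rfl
  | cons o h ih =>
    rw [balance, balance, ih]
    rcases o with _ | d
    · simp [sign]
    · cases c <;> cases d <;> simp [sign, Piece.other] <;> ring

lemma gain_eq (g : ℝ) (o : Outcome) :
    gain g o = 1 / 2 + |g - 1 / 2| * (sign (preferred g) o : ℝ) := by
  unfold preferred
  split_ifs with hg
  · rw [abs_of_pos (by linarith)]
    rcases o with _ | c
    · simp [gain, sign]
    · cases c
      · simp [gain, sign]
      · simp [gain, sign]; ring
  · rw [abs_of_nonpos (by linarith)]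
    rcases o with _ | c
    · simp [gain, sign]
    · cases c
      · simp [gain, sign]
      · simp [gain, sign]; ring

lemma totalGain_eq (g : ℝ) (h : History) :
    totalGain g h = h.length / 2 + |g - 1 / 2| * (balance (preferred g) h : ℝ) := by
  induction h with
  | nil => simp [totalGain]
  | cons o h ih =>
    have : totalGain g (o :: h) = gain g o + totalGain g h := by simp [totalGain]
    rw [this, ih, gain_eq, balance, List.length_cons]
    push_cast
    ring

lemma balance_eq {g : ℝ} (hg : g ≠ 1 / 2) (h : History) :
    balance (preferred g) h = (successes g h : ℤ) - failures g h := by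
  induction h with
  | nil => simp [successes, failures]
  | cons o h ih =>
    have hd : 0 < |g - 1 / 2| := abs_pos.2 (sub_ne_zero.2 hg)
    rw [balance, ih]
    simp only [successes, failures, List.countP_cons, gain_eq]
    have hs : sign (preferred g) o = 0 ∨ sign (preferred g) o = 1 ∨
        sign (preferred g) o = -1 := by
      rcases o with _ | c
      · simp [sign]
      · simp only [sign]; split_ifs <;> simp
    rcases hs with hs | hs | hs
    · simp [hs]
    · have : ¬ |g - 1 / 2| < 0 := by linarith
      simp [hs, -one_div, hd, this]; ring
    · have : ¬ |g - 1 / 2| < 0 := by linarith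
      simp [hs, -one_div, hd, this]; ring

lemma failures_le_successes_iff {g : ℝ} (hg : g ≠ 1 / 2) (h : History) :
    failures g h ≤ successes g h ↔ 0 ≤ balance (preferred g) h := by
  rw [balance_eq hg]; omega

lemma matchType_eq_one_iff {gA gB : ℝ} (hA : gA ≠ 1 / 2) (hB : gB ≠ 1 / 2) :
    matchType gA gB = 1 ↔ preferred gB = preferred gA := by
  unfold matchType preferred
  rcases lt_or_gt_of_ne hA with h1 | h1 <;> rcases lt_or_gt_of_ne hB with h2 | h2 <;>
    simp only [gt_iff_lt, h1, h2, h1.not_gt, h2.not_gt, and_true, and_false, or_false,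
      if_true, if_false, or_true] <;> simp

/-! ### Sums over the actions -/

lemma sum_piece (c : Piece) (f : Piece → ℝ) : ∑ d, f d = f c + f c.other := by
  have h : (Finset.univ : Finset Piece) = {.left, .right} := rfl
  rw [h, Finset.sum_pair (by simp)]
  cases c
  · rfl
  · exact add_comm _ _

lemma sum_cut (f : Cut → ℝ) : ∑ x, f x = f .risky + f .nonrisky := by
  have h : (Finset.univ : Finset Cut) = {.risky, .nonrisky} := rfl
  rw [h, Finset.sum_pair (by simp)]

lemma sum_outcome (f : Outcome → ℝ) :
    ∑ o, f o = f .nonrisky + ∑ c : Piece, f (.risky c) := by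
  have h : (Finset.univ : Finset Outcome) = {.nonrisky, .risky .left, .risky .right} := rfl
  rw [h, Finset.sum_insert (by simp), Finset.sum_pair (by simp), sum_piece .left]
  rfl

lemma lottery_other (l : Lottery Piece) (c : Piece) : l.1 c.other = 1 - l.1 c := by
  have := l.2.2
  rw [sum_piece c] at this
  linarith

lemma lottery_nonrisky (l : Lottery Cut) : l.1 .nonrisky = 1 - l.1 .risky := by
  have := l.2.2
  rw [sum_cut] at this
  linarith

lemma lottery_le_one {α : Type} [Fintype α] (l : Lottery α) (x : α) : l.1 x ≤ 1 := by
  have h := Finset.single_le_sum (f := l.1) (fun y _ => l.2.1 y) (Finset.mem_univ x)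
  rwa [l.2.2] at h

lemma value_succ (g : ℝ) (σ : AliceStrategy P) (τ : BobStrategy P) (a : P.suppA) (b : P.suppB)
    (m : ℕ) (h : History) :
    value g σ τ a b (m + 1) h = (1 - (σ a h).1 .risky) * value g σ τ a b m (.nonrisky :: h) +
      (σ a h).1 .risky * valueAfterRisk g σ τ a b m h := by
  rw [value, sum_outcome, valueAfterRisk, Finset.mul_sum, ← lottery_nonrisky]
  congr 1
  exact Finset.sum_congr rfl fun c _ => by simp only [stageProb]; ring

lemma valueAfterRisk_eq (c : Piece) (g : ℝ) (σ : AliceStrategy P) (τ : BobStrategy P)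
    (a : P.suppA) (b : P.suppB) (m : ℕ) (h : History) :
    valueAfterRisk g σ τ a b m h = (τ b h).1 c * value g σ τ a b m (.risky c :: h) +
      (1 - (τ b h).1 c) * value g σ τ a b m (.risky c.other :: h) := by
  rw [valueAfterRisk, sum_piece c, lottery_other]

/-! ### The expected final balance -/

/-- The expected balance after `m` more stages, from the balance `y`, when Alice risks with
probability `ρ y` and the balance then goes up with probability `κ` and down otherwise. -/
noncomputable def drift (ρ : ℤ → ℝ) (κ : ℝ) : ℕ → ℤ → ℝ
  | 0, y => y
  | m + 1, y => (1 - ρ y) * drift ρ κ m y +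
      ρ y * (κ * drift ρ κ m (y + 1) + (1 - κ) * drift ρ κ m (y - 1))

/-- The increment from y to y + 1 at level m + 1 is a combination of the level-m increments at y +
1, y and y - 1, with coefficients `ρ (y + 1) * κ`, `1 - ρ (y + 1) * (1 - κ) - ρ y * κ` and `ρ y * (1
- κ)`. All are nonnegative, so no monotonicity of `ρ` is needed. -/
lemma drift_mono {ρ : ℤ → ℝ} {κ : ℝ} (h0 : ∀ y, 0 ≤ ρ y) (h1 : ∀ y, ρ y ≤ 1) (hκ0 : 0 ≤ κ)
    (hκ1 : κ ≤ 1) (m : ℕ) : Monotone (drift ρ κ m) := by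
  refine monotone_int_of_le_succ fun y => ?_
  induction m generalizing y with
  | zero => simp [drift]
  | succ m ih =>
    have hA := sub_nonneg.2 (ih (y + 1))
    have hB := sub_nonneg.2 (ih y)
    have hC := sub_nonneg.2 (ih (y - 1))
    simp only [drift]
    rw [sub_add_cancel] at hC
    rw [add_sub_cancel_right]
    have hcoef : 0 ≤ 1 - ρ (y + 1) * (1 - κ) - ρ y * κ := by
      nlinarith [mul_le_mul_of_nonneg_right (h1 (y + 1)) (sub_nonneg.2 hκ1),
        mul_le_mul_of_nonneg_right (h1 y) hκ0]
    have e1 := mul_nonneg hcoef hB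
    have e2 := mul_nonneg (mul_nonneg (h0 (y + 1)) hκ0) hA
    have e3 := mul_nonneg (mul_nonneg (h0 y) (sub_nonneg.2 hκ1)) hC
    nlinarith

lemma value_eq_drift {g : ℝ} {σ : AliceStrategy P} {τ : BobStrategy P} {a : P.suppA}
    {b : P.suppB} {ρ : ℤ → ℝ} {κ : ℝ}
    (hσ : ∀ h, (σ a h).1 .risky = ρ (balance (preferred g) h))
    (hτ : ∀ h, (τ b h).1 (preferred g) = κ) (m : ℕ) (h : History) :
    value g σ τ a b m h = (h.length + m : ℕ) / 2 +
      |g - 1 / 2| * drift ρ κ m (balance (preferred g) h) := by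
  induction m generalizing h with
  | zero => simp [value, totalGain_eq, drift]
  | succ m ih =>
    rw [value_succ, valueAfterRisk_eq (preferred g), ih, ih, ih, hσ, hτ, drift]
    simp only [List.length_cons, balance_nonrisky, balance_self, balance_other]
    push_cast
    ring

lemma valueAfterRisk_eq_drift {g : ℝ} {σ : AliceStrategy P} {τ : BobStrategy P} {a : P.suppA}
    {b : P.suppB} {ρ : ℤ → ℝ} {κ : ℝ}
    (hσ : ∀ h, (σ a h).1 .risky = ρ (balance (preferred g) h))
    (hτ : ∀ h, (τ b h).1 (preferred g) = κ) (m : ℕ) (h : History) :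
    valueAfterRisk g σ τ a b m h = (h.length + m + 1 : ℕ) / 2 +
      |g - 1 / 2| * (κ * drift ρ κ m (balance (preferred g) h + 1) +
        (1 - κ) * drift ρ κ m (balance (preferred g) h - 1)) := by
  rw [valueAfterRisk_eq (preferred g), hτ, value_eq_drift hσ hτ, value_eq_drift hσ hτ]
  simp only [List.length_cons, balance_self, balance_other]
  push_cast
  ring

/-! ### Changing a strategy at one information set -/

lemma value_congr {g : ℝ} {σ₁ σ₂ : AliceStrategy P} {τ₁ τ₂ : BobStrategy P} {a : P.suppA}
    {b : P.suppB} (m : ℕ) (h : History)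
    (hyp : ∀ k, h <:+ k → stageProb σ₁ τ₁ a b k = stageProb σ₂ τ₂ a b k) :
    value g σ₁ τ₁ a b m h = value g σ₂ τ₂ a b m h := by
  induction m generalizing h with
  | zero => rfl
  | succ m ih =>
    rw [value, value, hyp h (List.suffix_refl h)]
    exact Finset.sum_congr rfl fun o _ => by
      rw [ih (o :: h) fun k hk => hyp k ((List.suffix_cons o h).trans hk)]

/-- Histories list the latest outcome first, so continuations of `h` are the lists with suffix `h`.
If the profiles differ only there, payoffs can differ only through plays that reach `h`. -/
lemma value_nil_sub {g : ℝ} {σ₁ σ₂ : AliceStrategy P} {τ₁ τ₂ : BobStrategy P} {a : P.suppA}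
    {b : P.suppB} (n : ℕ) (h : History) (hn : h.length ≤ n)
    (hyp : ∀ k, ¬ h <:+ k → stageProb σ₁ τ₁ a b k = stageProb σ₂ τ₂ a b k) :
    value g σ₁ τ₁ a b n [] - value g σ₂ τ₂ a b n [] = reachProb σ₂ τ₂ a b h *
      (value g σ₁ τ₁ a b (n - h.length) h - value g σ₂ τ₂ a b (n - h.length) h) := by
  induction h with
  | nil => simp [reachProb]
  | cons o h ih =>
    have hn' : h.length + 1 ≤ n := hn
    rw [ih (by omega) fun k hk => hyp k fun hk' => hk ((List.suffix_cons o h).trans hk'),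
      show n - h.length = (n - (o :: h).length) + 1 by simp; omega, value, value, reachProb,
      mul_assoc, ← Finset.sum_sub_distrib,
      hyp h fun hk => by simpa using hk.length_le, Finset.sum_eq_single o]
    · ring
    · intro o' _ ho
      -- A sibling branch `o' :: h` has no continuation in common with `o :: h`: two suffixes of
      -- equal length of one list coincide.
      rw [value_congr (σ₁ := σ₁) (τ₁ := τ₁) (σ₂ := σ₂) (τ₂ := τ₂) _ (o' :: h), sub_self]
      intro k hk
      refine hyp k fun hk' => ho ?_
      have := List.suffix_of_suffix_length_le hk hk' (by simp)
      simpa using this.eq_of_length (by simp)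
    · simp

/-- The payoff is affine in the risk probability at one information set, since no play visits that
set twice. The slope involves only the original profile, so its sign settles the local best
response. -/
lemma aliceGain_changeAt_sub (n : ℕ) (σ : AliceStrategy P) (τ : BobStrategy P) (a : P.suppA)
    (h : History) (hn : h.length < n) (q q' : Lottery Cut) :
    aliceGain n (changeAt σ a h q') τ - aliceGain n (changeAt σ a h q) τ =
      (q'.1 .risky - q.1 .risky) * ∑ b, P.p a b * (reachProb σ τ a b h *
        (valueAfterRisk a σ τ a b (n - h.length - 1) h -
          value a σ τ a b (n - h.length - 1) (.nonrisky :: h))) := by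
  have hstage : ∀ (r : Lottery Cut) (a' : P.suppA) (b : P.suppB) (k : History),
      (a' ≠ a ∨ k ≠ h) → stageProb (changeAt σ a h r) τ a' b k = stageProb σ τ a' b k := by
    intro r a' b k hk
    have : changeAt σ a h r a' k = σ a' k := if_neg (by tauto)
    funext o
    rcases o with _ | c <;> simp [stageProb, this]
  have hval : ∀ (r : Lottery Cut) (b : P.suppB),
      value a (changeAt σ a h r) τ a b n [] - value a σ τ a b n [] = reachProb σ τ a b h *
        ((1 - r.1 .risky) * value a σ τ a b (n - h.length - 1) (.nonrisky :: h) +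
          r.1 .risky * valueAfterRisk a σ τ a b (n - h.length - 1) h -
          value a σ τ a b (n - h.length) h) := by
    intro r b
    have hcongr : ∀ o, value a (changeAt σ a h r) τ a b (n - h.length - 1) (o :: h) =
        value a σ τ a b (n - h.length - 1) (o :: h) := fun o =>
      value_congr _ _ fun k hk => hstage r a b k (.inr fun hk' => by
        rw [hk'] at hk; simpa using hk.length_le)
    rw [value_nil_sub n h hn.le fun k hk => hstage r a b k (.inr fun hk' => hk (hk' ▸
      List.suffix_refl _))]
    congr 2
    conv_lhs => rw [show n - h.length = n - h.length - 1 + 1 by omega]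
    rw [value_succ, hcongr, valueAfterRisk, valueAfterRisk]
    simp only [hcongr]
    simp [changeAt]
  have hother : ∀ (r : Lottery Cut) (a' : P.suppA), a' ≠ a → ∀ b,
      value a' (changeAt σ a h r) τ a' b n [] = value a' σ τ a' b n [] := fun r a' ha b =>
    value_congr _ _ fun k _ => hstage r a' b k (.inl ha)
  rw [aliceGain, aliceGain, ← Finset.sum_sub_distrib, Finset.sum_eq_single a]
  · rw [← Finset.sum_sub_distrib, Finset.mul_sum]
    refine Finset.sum_congr rfl fun b _ => ?_
    linear_combination P.p a b * hval q' b - P.p a b * hval q b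
  · intro a' _ ha
    simp only [hother _ a' ha, sub_self]
  · simp

lemma bobGain_changeAt_sub (n : ℕ) (σ : AliceStrategy P) (τ : BobStrategy P) (b : P.suppB)
    (h : History) (hn : h.length < n) (c : Piece) (q q' : Lottery Piece) :
    bobGain n σ (changeAt τ b h q') - bobGain n σ (changeAt τ b h q) =
      (q'.1 c - q.1 c) * ∑ a, P.p a b * (reachProb σ τ a b h * ((σ a h).1 .risky *
        (value b σ τ a b (n - h.length - 1) (.risky c :: h) -
          value b σ τ a b (n - h.length - 1) (.risky c.other :: h)))) := by
  have hstage : ∀ (r : Lottery Piece) (a : P.suppA) (b' : P.suppB) (k : History),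
      (b' ≠ b ∨ k ≠ h) → stageProb σ (changeAt τ b h r) a b' k = stageProb σ τ a b' k := by
    intro r a b' k hk
    have : changeAt τ b h r b' k = τ b' k := if_neg (by tauto)
    funext o
    rcases o with _ | c <;> simp [stageProb, this]
  have hval : ∀ (r : Lottery Piece) (a : P.suppA),
      value b σ (changeAt τ b h r) a b n [] - value b σ τ a b n [] = reachProb σ τ a b h *
        ((1 - (σ a h).1 .risky) * value b σ τ a b (n - h.length - 1) (.nonrisky :: h) +
          (σ a h).1 .risky *
            (r.1 c * value b σ τ a b (n - h.length - 1) (.risky c :: h) +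
              (1 - r.1 c) * value b σ τ a b (n - h.length - 1) (.risky c.other :: h)) -
          value b σ τ a b (n - h.length) h) := by
    intro r a
    have hcongr : ∀ o, value b σ (changeAt τ b h r) a b (n - h.length - 1) (o :: h) =
        value b σ τ a b (n - h.length - 1) (o :: h) := fun o =>
      value_congr _ _ fun k hk => hstage r a b k (.inr fun hk' => by
        rw [hk'] at hk; simpa using hk.length_le)
    rw [value_nil_sub n h hn.le fun k hk => hstage r a b k (.inr fun hk' => hk (hk' ▸
      List.suffix_refl _))]
    congr 2
    conv_lhs => rw [show n - h.length = n - h.length - 1 + 1 by omega]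
    rw [value_succ, hcongr, valueAfterRisk_eq c, hcongr, hcongr]
    simp [changeAt]
  have hother : ∀ (r : Lottery Piece) (b' : P.suppB), b' ≠ b → ∀ a,
      value b' σ (changeAt τ b h r) a b' n [] = value b' σ τ a b' n [] := fun r b' hb a =>
    value_congr _ _ fun k _ => hstage r a b' k (.inl hb)
  rw [bobGain, bobGain, ← Finset.sum_sub_distrib, Finset.mul_sum]
  refine Finset.sum_congr rfl fun a _ => ?_
  rw [← Finset.sum_sub_distrib, Finset.sum_eq_single b]
  · linear_combination P.p a b * hval q' a - P.p a b * hval q a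
  · intro b' _ hb
    simp only [hother _ b' hb, sub_self]
  · simp

/-! ### Trembling strategies -/

/-- Alice risks with probability `r`. -/
noncomputable def mixCut (r : unitInterval) : Lottery Cut :=
  ⟨fun x => if x = .risky then r else 1 - r, by
    refine ⟨fun x => ?_, by simp [sum_cut]⟩
    dsimp only
    split_ifs
    · exact r.2.1
    · exact sub_nonneg.2 r.2.2⟩

/-- Bob chooses `c` with probability `r`. -/
noncomputable def mixPiece (c : Piece) (r : unitInterval) : Lottery Piece :=
  ⟨fun x => if x = c then r else 1 - r, by
    refine ⟨fun x => ?_, by simp [sum_piece c, Piece.other_ne]⟩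
    dsimp only
    split_ifs
    · exact r.2.1
    · exact sub_nonneg.2 r.2.2⟩

@[simp] lemma mixCut_risky (r : unitInterval) : (mixCut r).1 .risky = r := rfl

@[simp] lemma mixPiece_self (c : Piece) (r : unitInterval) : (mixPiece c r).1 c = r := if_pos rfl

lemma continuous_mixCut : Continuous mixCut := by
  refine Continuous.subtype_mk (continuous_pi fun x => ?_) _
  by_cases hx : x = .risky <;> simp only [hx, if_true, if_false] <;> fun_prop

lemma continuous_mixPiece (c : Piece) : Continuous (mixPiece c) := by
  refine Continuous.subtype_mk (continuous_pi fun x => ?_) _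
  by_cases hx : x = c <;> simp only [hx, if_true, if_false] <;> fun_prop

lemma lottery_cut_ext {l l' : Lottery Cut} (h : l.1 .risky = l'.1 .risky) : l = l' := by
  refine Subtype.ext (funext fun x => ?_)
  cases x
  · exact h
  · rw [lottery_nonrisky, lottery_nonrisky, h]

lemma lottery_piece_ext {l l' : Lottery Piece} (c : Piece) (h : l.1 c = l'.1 c) : l = l' := by
  refine Subtype.ext (funext fun x => ?_)
  by_cases hx : x = c
  · rw [hx]; exact h
  · rw [Piece.eq_other_of_ne hx, lottery_other, lottery_other, h]

/-- Alice's counting strategy with mistakes of probability `e`. -/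
noncomputable def aliceTremble (P : Prior) (e : unitInterval) : AliceStrategy P :=
  fun a h => mixCut (if failures a h ≤ successes a h then unitInterval.symm e else e)

/-- Bob's selfish strategy with mistakes of probability `e`. -/
noncomputable def bobTremble (P : Prior) (e : unitInterval) : BobStrategy P :=
  fun b _ => mixPiece (preferred b) (unitInterval.symm e)

lemma aliceTremble_zero : aliceTremble P 0 = aliceCounting P := by
  funext a h
  refine lottery_cut_ext ?_
  simp only [aliceTremble, aliceCounting, mixCut_risky, sure]
  split_ifs <;> simp

lemma bobSelfish_eq (b : P.suppB) (h : History) : bobSelfish P b h = sure (preferred b) := rfl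

lemma bobTremble_zero : bobTremble P 0 = bobSelfish P := by
  funext b h
  refine lottery_piece_ext (preferred b) ?_
  rw [bobSelfish_eq]
  simp [bobTremble, sure]

lemma continuous_aliceTremble (a : P.suppA) (h : History) :
    Continuous fun e => aliceTremble P e a h := by
  refine continuous_mixCut.comp ?_
  split_ifs
  · exact unitInterval.continuous_symm
  · exact continuous_id

lemma continuous_bobTremble (b : P.suppB) (h : History) :
    Continuous fun e => bobTremble P e b h :=
  (continuous_mixPiece _).comp unitInterval.continuous_symm

/-- The probability with which the trembling Alice risks at the balance `y`. -/
noncomputable def riskProb (e : ℝ) (y : ℤ) : ℝ := if 0 ≤ y then 1 - e else e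

lemma aliceTremble_risky (e : unitInterval) {a : P.suppA} (ha : (a : ℝ) ≠ 1 / 2) (h : History) :
    (aliceTremble P e a h).1 .risky = riskProb e (balance (preferred a) h) := by
  simp only [aliceTremble, mixCut_risky, riskProb, failures_le_successes_iff ha]
  split_ifs <;> rfl

/-- The probability that Bob makes the choice that Alice prefers, where `t` says whether their
preferences agree. -/
noncomputable def successProb (e : ℝ) (t : Prop) [Decidable t] : ℝ := if t then 1 - e else e

lemma bobTremble_preferred (e : unitInterval) (b : P.suppB) (h : History) :
    (bobTremble P e b h).1 (preferred b) = 1 - e := by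
  simp [bobTremble]

lemma bobTremble_success (e : unitInterval) (c : Piece) (b : P.suppB) (h : History) :
    (bobTremble P e b h).1 c = successProb e (preferred b = c) := by
  unfold successProb
  split_ifs with hc
  · rw [← hc, bobTremble_preferred]
  · have hb : c = (preferred b).other := Piece.eq_other_of_ne fun hc' => hc hc'.symm
    rw [hb, lottery_other, bobTremble_preferred]
    ring

/-! ### Bob's incentives -/

/-- Makes `drift_mono` applicable to Bob's balance: if the players prefer opposite pieces, Alice's
balance is the negative of his, and her risk probability is still a function of it. -/
lemma exists_risk_of_balance (e : unitInterval) {a : P.suppA} (ha : (a : ℝ) ≠ 1 / 2) (c : Piece) :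
    ∃ ρ : ℤ → ℝ, (∀ y, 0 ≤ ρ y) ∧ (∀ y, ρ y ≤ 1) ∧
      ∀ h, (aliceTremble P e a h).1 .risky = ρ (balance c h) := by
  have h0 : ∀ y, 0 ≤ riskProb e y := fun y => by
    unfold riskProb
    split_ifs
    · exact sub_nonneg.2 e.2.2
    · exact e.2.1
  have h1 : ∀ y, riskProb e y ≤ 1 := fun y => by
    unfold riskProb
    split_ifs
    · linarith [e.2.1]
    · exact e.2.2
  by_cases hc : preferred a = c
  · exact ⟨riskProb e, h0, h1, fun h => by rw [aliceTremble_risky e ha, hc]⟩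
  · refine ⟨fun y => riskProb e (-y), fun y => h0 _, fun y => h1 _, fun h => ?_⟩
    rw [aliceTremble_risky e ha, Piece.eq_other_of_ne hc, balance_other_left]

lemma value_other_le_value_preferred (e : unitInterval) {a : P.suppA} (ha : (a : ℝ) ≠ 1 / 2)
    (b : P.suppB) (m : ℕ) (h : History) :
    value b (aliceTremble P e) (bobTremble P e) a b m (.risky (preferred b).other :: h) ≤
      value b (aliceTremble P e) (bobTremble P e) a b m (.risky (preferred b) :: h) := by
  obtain ⟨ρ, h0, h1, hρ⟩ := exists_risk_of_balance (P := P) e ha (preferred b)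
  have hmono := drift_mono h0 h1 (sub_nonneg.2 e.2.2) (sub_le_self _ e.2.1) m
  rw [value_eq_drift hρ (bobTremble_preferred e b), value_eq_drift hρ (bobTremble_preferred e b)]
  simp only [List.length_cons, balance_self, balance_other]
  gcongr
  exact hmono (by linarith)

lemma reachProb_nonneg (σ : AliceStrategy P) (τ : BobStrategy P) (a : P.suppA) (b : P.suppB)
    (h : History) : 0 ≤ reachProb σ τ a b h := by
  induction h with
  | nil => exact zero_le_one
  | cons o h ih =>
    refine mul_nonneg ih ?_
    rcases o with _ | c
    · exact (σ a h).2.1 _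
    · exact mul_nonneg ((σ a h).2.1 _) ((τ b h).2.1 _)

lemma bobGain_tremble_le (hA : ∀ a : P.suppA, (a : ℝ) ≠ 1 / 2) (e : unitInterval) (n : ℕ)
    (b : P.suppB) (h : History) (hn : h.length < n) (q : Lottery Piece) :
    bobGain n (aliceTremble P e) (changeAt (bobTremble P e) b h q) ≤
      bobGain n (aliceTremble P e) (changeAt (bobTremble P e) b h (bobSelfish P b h)) := by
  rw [← sub_nonneg, bobGain_changeAt_sub n _ _ b h hn (preferred b)]
  refine mul_nonneg ?_ (Finset.sum_nonneg fun a _ => ?_)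
  · rw [bobSelfish_eq]
    simpa [sure] using lottery_le_one q (preferred b)
  · exact mul_nonneg (P.p_nonneg a b) (mul_nonneg (reachProb_nonneg _ _ _ _ _)
      (mul_nonneg ((aliceTremble P e a h).2.1 _)
        (sub_nonneg.2 (value_other_le_value_preferred e (hA a) b _ h))))

lemma valueAfterRisk_selfish (g : ℝ) (σ : AliceStrategy P) (a : P.suppA) (b : P.suppB) (m : ℕ)
    (h : History) : valueAfterRisk g σ (bobSelfish P) a b m h =
      value g σ (bobSelfish P) a b m (.risky (preferred b) :: h) := by
  rw [valueAfterRisk_eq (preferred b), bobSelfish_eq]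
  simp [sure]

/-- The backward-induction step, carried out for each fixed `a`, so that averaging over any belief
about `G_A` preserves the inequality. -/
lemma bob_mix_le {a : P.suppA} (ha : (a : ℝ) ≠ 1 / 2) (b : P.suppB) (m : ℕ) (h : History)
    {τ : BobStrategy P}
    (hval : ∀ k, value b (aliceCounting P) τ a b m k ≤
      value b (aliceCounting P) (bobSelfish P) a b m k) :
    valueAfterRisk b (aliceCounting P) τ a b m h ≤
      valueAfterRisk b (aliceCounting P) (bobSelfish P) a b m h := by
  have hle := value_other_le_value_preferred (P := P) 0 ha b m h
  rw [aliceTremble_zero, bobTremble_zero] at hle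
  rw [valueAfterRisk_selfish, valueAfterRisk_eq (preferred b)]
  have h0 := (τ b h).2.1 (preferred b)
  have h1 := sub_nonneg.2 (lottery_le_one (τ b h) (preferred b))
  have e1 := mul_le_mul_of_nonneg_left (hval (.risky (preferred b) :: h)) h0
  have e2 := mul_le_mul_of_nonneg_left ((hval (.risky (preferred b).other :: h)).trans hle) h1
  linarith

lemma bob_value_le {a : P.suppA} (ha : (a : ℝ) ≠ 1 / 2) (b : P.suppB) (τ : BobStrategy P)
    (m : ℕ) (h : History) :
    value b (aliceCounting P) τ a b m h ≤ value b (aliceCounting P) (bobSelfish P) a b m h := by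
  induction m generalizing h with
  | zero => rfl
  | succ m ih =>
    rw [value_succ, value_succ]
    have h1 := sub_nonneg.2 (lottery_le_one (aliceCounting P a h) .risky)
    exact add_le_add (mul_le_mul_of_nonneg_left (ih _) h1)
      (mul_le_mul_of_nonneg_left (bob_mix_le ha b m h ih) ((aliceCounting P a h).2.1 _))

lemma bob_valueAfterRisk_le {a : P.suppA} (ha : (a : ℝ) ≠ 1 / 2) (b : P.suppB)
    (τ : BobStrategy P) (m : ℕ) (h : History) :
    valueAfterRisk b (aliceCounting P) τ a b m h ≤
      valueAfterRisk b (aliceCounting P) (bobSelfish P) a b m h :=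
  bob_mix_le ha b m h (bob_value_le ha b τ m)

/-! ### Likelihoods -/

/-- Up to a factor that does not depend on `t`, the probability of `s` successes and `f`
failures. -/
noncomputable def likelihood (e : ℝ) (s f : ℕ) (t : Prop) [Decidable t] : ℝ :=
  if t then (1 - e) ^ (s - f) * e ^ (f - s) else e ^ (s - f) * (1 - e) ^ (f - s)

/-- A success paired with a failure has probability `e * (1 - e)` whether or not preferences agree.
Removing all such pairs removes the common factor vanishing at e = 0, so that Bayes' rule extends
continuously to e = 0. -/
lemma successProb_pow (e : ℝ) (s f : ℕ) (t : Prop) [Decidable t] :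
    successProb e t ^ s * (1 - successProb e t) ^ f =
      (e * (1 - e)) ^ min s f * likelihood e s f t := by
  unfold successProb likelihood
  rcases le_total s f with hsf | hsf
  · obtain ⟨k, rfl⟩ := Nat.exists_eq_add_of_le hsf
    split_ifs <;> simp [pow_add, mul_pow] <;> ring
  · obtain ⟨k, rfl⟩ := Nat.exists_eq_add_of_le hsf
    split_ifs <;> simp [pow_add, mul_pow] <;> ring

lemma continuous_likelihood (s f : ℕ) (t : Prop) [Decidable t] :
    Continuous fun e : ℝ => likelihood e s f t := by
  unfold likelihood
  split_ifs <;> fun_prop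

lemma likelihood_nonneg {e : ℝ} (h0 : 0 ≤ e) (h1 : e ≤ 1) (s f : ℕ) (t : Prop) [Decidable t] :
    0 ≤ likelihood e s f t := by
  have := sub_nonneg.2 h1
  unfold likelihood
  split_ifs <;> positivity

lemma likelihood_zero (s f : ℕ) (t : Prop) [Decidable t] :
    likelihood 0 s f t = if t then (if f ≤ s then 1 else 0) else (if s ≤ f then 1 else 0) := by
  unfold likelihood
  simp [zero_pow_eq, Nat.sub_eq_zero_iff_le]

/-- The factor of `reachProb` due to Alice. -/
noncomputable def aliceReach (σ : AliceStrategy P) (a : P.suppA) : History → ℝ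
  | [] => 1
  | .nonrisky :: h => aliceReach σ a h * (σ a h).1 .nonrisky
  | .risky _ :: h => aliceReach σ a h * (σ a h).1 .risky

lemma aliceReach_pos {σ : AliceStrategy P} {a : P.suppA} (hσ : ∀ h x, 0 < (σ a h).1 x)
    (h : History) : 0 < aliceReach σ a h := by
  induction h with
  | nil => exact zero_lt_one
  | cons o h ih => rcases o with _ | c <;> exact mul_pos ih (hσ h _)

lemma reachProb_eq {σ : AliceStrategy P} {τ : BobStrategy P} {a : P.suppA} {b : P.suppB} {κ : ℝ}
    (ha : (a : ℝ) ≠ 1 / 2) (hτ : ∀ h, (τ b h).1 (preferred a) = κ) (h : History) :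
    reachProb σ τ a b h = aliceReach σ a h *
      (κ ^ successes a h * (1 - κ) ^ failures a h) := by
  have hd : 0 < |(a : ℝ) - 1 / 2| := abs_pos.2 (sub_ne_zero.2 ha)
  induction h with
  | nil => simp [reachProb, aliceReach, successes, failures]
  | cons o h ih =>
    rw [reachProb, ih]
    rcases o with _ | c
    · simp [aliceReach, successes, failures, stageProb, gain]
      ring
    · have hd' : ¬ |(a : ℝ) - 1 / 2| < 0 := by linarith
      by_cases hc : c = preferred a
      · have hs : successes a (.risky c :: h) = successes a h + 1 := by
          simp [successes, gain_eq, sign, hc, hd, -one_div]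
        have hf : failures a (.risky c :: h) = failures a h := by
          simp [failures, gain_eq, sign, hc, hd', -one_div]
        rw [hs, hf, aliceReach, stageProb, hc, hτ]
        ring
      · have hs : successes a (.risky c :: h) = successes a h := by
          simp [successes, gain_eq, sign, hc, hd', -one_div]
        have hf : failures a (.risky c :: h) = failures a h + 1 := by
          simp [failures, gain_eq, sign, hc, hd, -one_div]
        rw [hs, hf, aliceReach, stageProb, Piece.eq_other_of_ne hc, lottery_other, hτ]
        ring

/-- The probability of Bob's valuation at Alice's information set `(a, h)`, up to a factor that
does not depend on it. -/
noncomputable def weight (e : ℝ) (a : P.suppA) (h : History) (b : P.suppB) : ℝ :=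
  P.p a b * likelihood e (successes a h) (failures a h) (preferred b = preferred a)

/-- The constant `C` is the same for all `b`: it cancels in Bayes' rule and, being positive, does
not affect the sign of Alice's incentives. -/
lemma exists_reachProb_eq {e : unitInterval} (h0 : 0 < (e : ℝ)) (h1 : (e : ℝ) < 1) {a : P.suppA}
    (ha : (a : ℝ) ≠ 1 / 2) (h : History) : ∃ C : ℝ, 0 < C ∧ ∀ b,
      P.p a b * reachProb (aliceTremble P e) (bobTremble P e) a b h = C * weight e a h b := by
  have h1' := sub_pos.2 h1
  refine ⟨aliceReach (aliceTremble P e) a h *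
    ((e : ℝ) * (1 - e)) ^ min (successes a h) (failures a h), ?_, fun b => ?_⟩
  · refine mul_pos (aliceReach_pos (fun k x => ?_) h) (by positivity)
    cases x
    · rw [aliceTremble_risky e ha, riskProb]
      split_ifs <;> assumption
    · rw [lottery_nonrisky, aliceTremble_risky e ha, riskProb]
      split_ifs
      · simpa
      · assumption
  · rw [reachProb_eq ha (bobTremble_success e (preferred a) b), successProb_pow, weight]
    ring

/-! ### The prior -/

lemma condT_one_eq {a : P.suppA} (ha : (a : ℝ) ≠ 1 / 2) (hB : ∀ b : P.suppB, (b : ℝ) ≠ 1 / 2) :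
    P.condT 1 a =
      (∑ b : P.suppB, if preferred b = preferred a then P.p a b else 0) / ∑ b, P.p a b := by
  simp only [Prior.condT, matchType_eq_one_iff ha (hB _)]

lemma condT_zero_eq {a : P.suppA} (ha : (a : ℝ) ≠ 1 / 2) (hB : ∀ b : P.suppB, (b : ℝ) ≠ 1 / 2) :
    P.condT 0 a =
      (∑ b : P.suppB, if preferred b = preferred a then 0 else P.p a b) / ∑ b, P.p a b := by
  have h0 : ∀ t : Fin 2, t = 0 ↔ ¬ t = 1 := by decide
  simp only [Prior.condT, h0, matchType_eq_one_iff ha (hB _), ite_not]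

lemma disagree_pos {a : P.suppA} (ha : (a : ℝ) ≠ 1 / 2) (hB : ∀ b : P.suppB, (b : ℝ) ≠ 1 / 2)
    (hT : P.condT 0 a ≠ 0) :
    0 < ∑ b : P.suppB, if preferred b = preferred a then 0 else P.p a b := by
  refine lt_of_le_of_ne (Finset.sum_nonneg fun b _ => ?_) fun h => hT ?_
  · split_ifs
    · exact le_rfl
    · exact P.p_nonneg a b
  · rw [condT_zero_eq ha hB, ← h, zero_div]

lemma disagree_lt_agree {a : P.suppA} (ha : (a : ℝ) ≠ 1 / 2)
    (hB : ∀ b : P.suppB, (b : ℝ) ≠ 1 / 2)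
    (hRisk : P.condT 0 a * min (a : ℝ) (1 - a) + P.condT 1 a * max (a : ℝ) (1 - a) > 1 / 2) :
    (∑ b : P.suppB, if preferred b = preferred a then 0 else P.p a b) <
      ∑ b : P.suppB, if preferred b = preferred a then P.p a b else 0 := by
  have hN := P.margA_pos a
  have hsum : P.condT 0 a + P.condT 1 a = 1 := by
    rw [condT_one_eq ha hB, condT_zero_eq ha hB, ← add_div, ← Finset.sum_add_distrib,
      div_eq_one_iff_eq hN.ne']
    exact Finset.sum_congr rfl fun b _ => by split_ifs <;> simp
  have hd : 0 < |(a : ℝ) - 1 / 2| := abs_pos.2 (sub_ne_zero.2 ha)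
  -- With d = `|a - 1/2|` the minimum and maximum are 1/2 - d and 1/2 + d, so `hRisk` says that d
  -- times the difference of the conditional probabilities is positive.
  have hmin : min (a : ℝ) (1 - a) = 1 / 2 - |(a : ℝ) - 1 / 2| := by
    rcases abs_cases ((a : ℝ) - 1 / 2) with ⟨h, h'⟩ | ⟨h, h'⟩
    · rw [h, min_eq_right (by linarith)]; ring
    · rw [h, min_eq_left (by linarith)]; ring
  have hmax : max (a : ℝ) (1 - a) = 1 / 2 + |(a : ℝ) - 1 / 2| := by
    linarith [min_add_max (a : ℝ) (1 - a)]
  rw [hmin, hmax] at hRisk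
  have hlt : P.condT 0 a < P.condT 1 a := by
    have h : 0 < |(a : ℝ) - 1 / 2| * (P.condT 1 a - P.condT 0 a) := by
      linear_combination hRisk + (1 / 2) * hsum
    exact sub_pos.1 ((pos_iff_pos_of_mul_pos h).1 hd)
  rwa [condT_one_eq ha hB, condT_zero_eq ha hB, div_lt_div_iff_of_pos_right hN] at hlt

/-- The property of the prior on which Alice's incentives rest: at `a`, disagreement with Bob has
positive probability, and agreement has a larger one. -/
def FavorsRisk (a : P.suppA) : Prop :=
  (0 < ∑ b : P.suppB, if preferred b = preferred a then 0 else P.p a b) ∧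
  (∑ b : P.suppB, if preferred b = preferred a then 0 else P.p a b) <
    ∑ b : P.suppB, if preferred b = preferred a then P.p a b else 0

/-! ### Alice's local incentives -/

lemma continuous_drift (t : Prop) [Decidable t] (m : ℕ) (y : ℤ) :
    Continuous fun e : ℝ => drift (riskProb e) (successProb e t) m y := by
  have hρ : ∀ y, Continuous fun e : ℝ => riskProb e y := fun y => by
    unfold riskProb
    split_ifs <;> fun_prop
  have hκ : Continuous fun e : ℝ => successProb e t := by
    unfold successProb
    split_ifs <;> fun_prop
  induction m generalizing y with
  | zero => exact continuous_const
  | succ m ih =>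
    have h1 := hρ y
    have h2 := ih y
    have h3 := ih (y + 1)
    have h4 := ih (y - 1)
    simp only [drift]
    fun_prop

lemma drift_of_neg (κ : ℝ) (m : ℕ) {y : ℤ} (hy : y < 0) : drift (riskProb 0) κ m y = y := by
  induction m with
  | zero => rfl
  | succ m ih => simp [drift, ih, riskProb, hy.not_ge]

lemma drift_of_nonneg (m : ℕ) {y : ℤ} (hy : 0 ≤ y) : drift (riskProb 0) 1 m y = y + m := by
  induction m generalizing y with
  | zero => simp [drift]
  | succ m ih =>
    rw [drift, ih (show (0 : ℤ) ≤ y + 1 by omega)]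
    simp [riskProb, hy]
    ring

/-- Under disagreement Alice risks once, loses one unit and then stops; with no stage left she loses
nothing. -/
lemma drift_zero_zero (m : ℕ) : drift (riskProb 0) 0 m 0 = if m = 0 then 0 else -1 := by
  cases m with
  | zero => simp [drift]
  | succ m => simp [drift, riskProb, drift_of_neg]

/-- The expected effect on the final balance of risking now, `m` stages before the end, instead of
not risking. -/
noncomputable def edge (e : ℝ) (t : Prop) [Decidable t] (m : ℕ) (y : ℤ) : ℝ :=
  successProb e t * drift (riskProb e) (successProb e t) m (y + 1) +
    (1 - successProb e t) * drift (riskProb e) (successProb e t) m (y - 1) -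
    drift (riskProb e) (successProb e t) m y

/-- The sum of `edge` with respect to `weight`. -/
noncomputable def totalEdge (e : ℝ) (a : P.suppA) (h : History) (m : ℕ) : ℝ :=
  ∑ b, weight e a h b * edge e (preferred b = preferred a) m (balance (preferred a) h)

lemma continuous_weight (a : P.suppA) (h : History) (b : P.suppB) :
    Continuous fun e => weight e a h b :=
  continuous_const.mul (continuous_likelihood _ _ _)

lemma continuous_totalEdge (a : P.suppA) (h : History) (m : ℕ) :
    Continuous fun e => totalEdge e a h m := by
  refine continuous_finsetSum _ fun b _ => (continuous_weight a h b).mul ?_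
  have hκ : Continuous fun e : ℝ => successProb e (preferred b = preferred a) := by
    unfold successProb
    split_ifs <;> fun_prop
  have h1 := continuous_drift (preferred b = preferred a) m
  unfold edge
  exact ((hκ.mul (h1 _)).add ((continuous_const.sub hκ).mul (h1 _))).sub (h1 _)

lemma weight_zero (a : P.suppA) (h : History) (b : P.suppB) :
    weight 0 a h b = if preferred b = preferred a
      then (if failures a h ≤ successes a h then P.p a b else 0)
      else (if successes a h ≤ failures a h then P.p a b else 0) := by
  rw [weight, likelihood_zero]
  split_ifs <;> simp

lemma weight_zero_nonneg (a : P.suppA) (h : History) (b : P.suppB) : 0 ≤ weight 0 a h b :=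
  mul_nonneg (P.p_nonneg a b) (likelihood_nonneg le_rfl zero_le_one _ _ _)

/-- The limit weights include all the mass of agreement or all that of disagreement, both positive;
hence limit beliefs exist even at unreached information sets. -/
lemma sum_weight_zero_pos {a : P.suppA} (hF : FavorsRisk a) (h : History) :
    0 < ∑ b, weight 0 a h b := by
  simp only [weight_zero]
  rcases le_total (failures a h) (successes a h) with hle | hle
  · refine (hF.1.trans hF.2).trans_le (Finset.sum_le_sum fun b _ => ?_)
    simp only [hle, if_true]
    have := P.p_nonneg a b
    split_ifs <;> first | exact le_rfl | assumption
  · refine hF.1.trans_le (Finset.sum_le_sum fun b _ => ?_)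
    simp only [hle, if_true]
    have := P.p_nonneg a b
    split_ifs <;> first | exact le_rfl | assumption

/-- Under agreement risking adds exactly one unit; under disagreement, which has weight only at
balance 0, it costs at most one. The difference of the two prior masses is a positive lower bound.
-/
lemma totalEdge_zero_pos {a : P.suppA} (ha : (a : ℝ) ≠ 1 / 2) (hF : FavorsRisk a) (h : History)
    (hle : failures a h ≤ successes a h) (m : ℕ) : 0 < totalEdge 0 a h m := by
  have hy := balance_eq ha h
  have hy0 : 0 ≤ balance (preferred a) h := by omega
  have hedge : edge 0 True m (balance (preferred a) h) = 1 := by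
    simp only [edge, successProb, if_true, sub_zero, sub_self, zero_mul, one_mul, add_zero]
    rw [drift_of_nonneg m hy0, drift_of_nonneg m (by omega)]
    push_cast
    ring
  refine (sub_pos.2 hF.2).trans_le ?_
  rw [totalEdge, ← Finset.sum_sub_distrib]
  refine Finset.sum_le_sum fun b _ => ?_
  have hp := P.p_nonneg a b
  rw [weight_zero]
  by_cases ht : preferred b = preferred a
  · simp [ht, hle, hedge]
  · by_cases hge : successes a h ≤ failures a h
    · have h0 : balance (preferred a) h = 0 := by omega
      -- The full unit is lost only at the last stage; earlier, not risking merely postpones the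
      -- same loss.
      have hneg : -1 ≤ edge 0 False m 0 := by
        simp only [edge, successProb, if_false, zero_mul, sub_zero, one_mul, zero_add, zero_sub]
        rw [drift_of_neg 0 m (by decide), drift_zero_zero]
        split_ifs <;> norm_num
      simp only [ht, hge, h0, if_true, if_false]
      nlinarith
    · simp [ht, hge, hp]

/-- Only disagreement has weight here, and a risk costs exactly one unit because Alice stops
afterwards. Strictness requires disagreement to have positive prior probability. -/
lemma totalEdge_zero_neg {a : P.suppA} (ha : (a : ℝ) ≠ 1 / 2) (hF : FavorsRisk a) (h : History)
    (hlt : ¬ failures a h ≤ successes a h) (m : ℕ) : totalEdge 0 a h m < 0 := by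
  have hy := balance_eq ha h
  have hy0 : balance (preferred a) h < 0 := by omega
  have hge : successes a h ≤ failures a h := by omega
  have hedge : edge 0 False m (balance (preferred a) h) = -1 := by
    simp only [edge, successProb, if_false, zero_mul, sub_zero, one_mul, zero_add]
    rw [drift_of_neg 0 m hy0, drift_of_neg 0 m (by omega)]
    push_cast
    ring
  have heq : totalEdge 0 a h m =
      -∑ b : P.suppB, if preferred b = preferred a then 0 else P.p a b := by
    rw [totalEdge, ← Finset.sum_neg_distrib]
    refine Finset.sum_congr rfl fun b _ => ?_
    rw [weight_zero]
    by_cases ht : preferred b = preferred a <;> simp [ht, hlt, hge, hedge]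
  rw [heq]
  exact neg_neg_of_pos hF.1

lemma aliceGain_tremble_le {e : unitInterval} (h0 : 0 < (e : ℝ)) (h1 : (e : ℝ) < 1) {a : P.suppA}
    (ha : (a : ℝ) ≠ 1 / 2) (n : ℕ) (h : History) (hn : h.length < n)
    (hpos : failures a h ≤ successes a h → 0 < totalEdge (e : ℝ) a h (n - h.length - 1))
    (hneg : ¬ failures a h ≤ successes a h → totalEdge (e : ℝ) a h (n - h.length - 1) < 0)
    (q : Lottery Cut) :
    aliceGain n (changeAt (aliceTremble P e) a h q) (bobTremble P e) ≤
      aliceGain n (changeAt (aliceTremble P e) a h (aliceCounting P a h)) (bobTremble P e) := by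
  obtain ⟨C, hC, hreach⟩ := exists_reachProb_eq h0 h1 ha h
  rw [← sub_nonneg, aliceGain_changeAt_sub n _ _ a h hn]
  have hsum : ∑ b, P.p a b * (reachProb (aliceTremble P e) (bobTremble P e) a b h *
      (valueAfterRisk a (aliceTremble P e) (bobTremble P e) a b (n - h.length - 1) h -
        value a (aliceTremble P e) (bobTremble P e) a b (n - h.length - 1) (.nonrisky :: h))) =
      C * (|(a : ℝ) - 1 / 2| * totalEdge (e : ℝ) a h (n - h.length - 1)) := by
    rw [totalEdge, Finset.mul_sum, Finset.mul_sum]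
    refine Finset.sum_congr rfl fun b _ => ?_
    have hσ := aliceTremble_risky e ha
    have hτ := bobTremble_success e (preferred a) b
    rw [← mul_assoc, hreach, valueAfterRisk_eq_drift hσ hτ, value_eq_drift hσ hτ, edge,
      balance_nonrisky, List.length_cons]
    push_cast
    ring
  rw [hsum]
  have hd := abs_nonneg ((a : ℝ) - 1 / 2)
  by_cases hle : failures a h ≤ successes a h
  · refine mul_nonneg ?_ (mul_nonneg hC.le (mul_nonneg hd (hpos hle).le))
    simpa [aliceCounting, hle, sure] using lottery_le_one q .risky
  · refine mul_nonneg_of_nonpos_of_nonpos ?_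
      (mul_nonpos_of_nonneg_of_nonpos hC.le (mul_nonpos_of_nonneg_of_nonpos hd (hneg hle).le))
    simpa [aliceCounting, hle, sure] using q.2.1 .risky

lemma completelyMixed_tremble (n : ℕ) {e : unitInterval} (h0 : 0 < (e : ℝ)) (h1 : (e : ℝ) < 1) :
    CompletelyMixed n (aliceTremble P e) (bobTremble P e) := by
  have h1' := sub_pos.2 h1
  refine ⟨fun a h _ x => ?_, fun b h _ c => ?_⟩
  · have hr : 0 < (aliceTremble P e a h).1 .risky ∧ (aliceTremble P e a h).1 .risky < 1 := by
      simp only [aliceTremble, mixCut_risky]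
      split_ifs
      · exact ⟨by simpa using h1, by simpa using h0⟩
      · exact ⟨h0, h1⟩
    cases x
    · exact hr.1
    · rw [lottery_nonrisky]; exact sub_pos.2 hr.2
  · rw [bobTremble_success, successProb]
    split_ifs <;> assumption

lemma convergesTo_tremble (n : ℕ) {es : ℕ → unitInterval} (hes : Tendsto es atTop (𝓝 0)) :
    ConvergesTo n (fun i => aliceTremble P (es i)) (fun i => bobTremble P (es i))
      (aliceCounting P) (bobSelfish P) := by
  rw [← aliceTremble_zero, ← bobTremble_zero]
  exact ⟨fun a h _ => ((continuous_aliceTremble a h).tendsto 0).comp hes,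
    fun b h _ => ((continuous_bobTremble b h).tendsto 0).comp hes⟩

lemma exists_mistake_seq : ∃ es : ℕ → unitInterval,
    (∀ i, 0 < (es i : ℝ) ∧ (es i : ℝ) < 1) ∧ Tendsto es atTop (𝓝 0) := by
  -- The shift by 2 keeps the mistake probability below 1 already at i = 0, as complete mixing
  -- demands.
  have hpos : ∀ i : ℕ, 0 < 1 / ((i : ℝ) + 2) ∧ 1 / ((i : ℝ) + 2) < 1 := fun i => by
    have hi : (0 : ℝ) ≤ i := i.cast_nonneg
    exact ⟨by positivity, by rw [div_lt_one (by positivity)]; linarith⟩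
  refine ⟨fun i => ⟨1 / ((i : ℝ) + 2), (hpos i).1.le, (hpos i).2.le⟩, hpos, ?_⟩
  rw [tendsto_subtype_rng]
  have := (tendsto_one_div_add_atTop_nhds_zero_nat (𝕜 := ℝ)).comp (tendsto_add_atTop_nat 1)
  refine this.congr fun i => ?_
  simp only [Function.comp_apply]
  push_cast
  ring

instance : Finite Outcome := Finite.of_fintype _

theorem isTHP_counting_selfish (hA : ∀ a : P.suppA, (a : ℝ) ≠ 1 / 2)
    (hF : ∀ a : P.suppA, FavorsRisk a) (n : ℕ) :
    IsTHP n (aliceCounting P) (bobSelfish P) := by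
  obtain ⟨es, hes, hlim⟩ := exists_mistake_seq
  have hlim' : Tendsto (fun i => (es i : ℝ)) atTop (𝓝 0) := by
    simpa using tendsto_subtype_rng.1 hlim
  have hev : ∀ᶠ i in atTop, ∀ a : P.suppA, ∀ h ∈ {h : History | h.length < n},
      (failures a h ≤ successes a h → 0 < totalEdge (es i : ℝ) a h (n - h.length - 1)) ∧
      (¬ failures a h ≤ successes a h → totalEdge (es i : ℝ) a h (n - h.length - 1) < 0) := by
    rw [eventually_all]
    intro a
    rw [(List.finite_length_lt Outcome n).eventually_all]
    intro h _
    have ht := ((continuous_totalEdge a h (n - h.length - 1)).tendsto 0).comp hlim'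
    by_cases hle : failures a h ≤ successes a h
    · filter_upwards [ht.eventually_const_lt (totalEdge_zero_pos (hA a) (hF a) h hle _)] with i hi
      exact ⟨fun _ => hi, fun h' => absurd hle h'⟩
    · filter_upwards [ht.eventually_lt_const (totalEdge_zero_neg (hA a) (hF a) h hle _)] with i hi
      exact ⟨fun h' => absurd h' hle, fun _ => hi⟩
  -- Perfection constrains every member of the sequence, so its first `N` terms are dropped.
  obtain ⟨N, hN⟩ := eventually_atTop.1 hev
  refine ⟨fun i => aliceTremble P (es (i + N)), fun i => bobTremble P (es (i + N)),
    fun i => completelyMixed_tremble n (hes _).1 (hes _).2,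
    convergesTo_tremble n (hlim.comp (tendsto_add_atTop_nat N)), fun i a h hn q => ?_,
    fun i b h hn q => bobGain_tremble_le hA _ n b h hn q⟩
  have := hN (i + N) (Nat.le_add_left _ _) a h hn
  exact aliceGain_tremble_le (hes _).1 (hes _).2 (hA a) n h hn this.1 this.2 q

/-! ### Alice's global incentives -/

lemma alice_value_le_of_agree (σ : AliceStrategy P) (a : P.suppA) {b : P.suppB}
    (hb : preferred b = preferred a) (m : ℕ) (h : History) :
    value a σ (bobSelfish P) a b m h ≤ (h.length + m : ℕ) / 2 +
      |(a : ℝ) - 1 / 2| * (balance (preferred a) h + m) := by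
  have hd := abs_nonneg ((a : ℝ) - 1 / 2)
  induction m generalizing h with
  | zero => simp [value, totalGain_eq]
  | succ m ih =>
    rw [value_succ, valueAfterRisk_selfish, hb]
    have h0 := (σ a h).2.1 .risky
    have h1 := sub_nonneg.2 (lottery_le_one (σ a h) .risky)
    have e1 := ih (.nonrisky :: h)
    have e2 := ih (.risky (preferred a) :: h)
    simp only [List.length_cons, balance_nonrisky, balance_self] at e1 e2
    push_cast at e1 e2 ⊢
    nlinarith [mul_le_mul_of_nonneg_left e1 h1, mul_le_mul_of_nonneg_left e2 h0,
      mul_nonneg h1 hd]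

lemma alice_value_le_of_disagree (σ : AliceStrategy P) (a : P.suppA) {b : P.suppB}
    (hb : preferred b ≠ preferred a) (m : ℕ) (h : History) :
    value a σ (bobSelfish P) a b m h ≤ (h.length + m : ℕ) / 2 +
      |(a : ℝ) - 1 / 2| * balance (preferred a) h := by
  have hd := abs_nonneg ((a : ℝ) - 1 / 2)
  induction m generalizing h with
  | zero => simp [value, totalGain_eq]
  | succ m ih =>
    rw [value_succ, valueAfterRisk_selfish, Piece.eq_other_of_ne hb]
    have h0 := (σ a h).2.1 .risky
    have h1 := sub_nonneg.2 (lottery_le_one (σ a h) .risky)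
    have e1 := ih (.nonrisky :: h)
    have e2 := ih (.risky (preferred a).other :: h)
    simp only [List.length_cons, balance_nonrisky, balance_other] at e1 e2
    push_cast at e1 e2 ⊢
    nlinarith [mul_le_mul_of_nonneg_left e1 h1, mul_le_mul_of_nonneg_left e2 h0,
      mul_nonneg h0 hd]

/-- The bound allows Alice to win all `m` remaining stages under agreement at the price of one unit
under disagreement. Waiting cannot beat it, as a further stage raises the weighted bound by at least
`|a - 1/2|` times agreement minus disagreement; after a risk the case is revealed and the bounds for
known agreement and disagreement apply. -/
lemma alice_sum_value_le (σ : AliceStrategy P) (a : P.suppA) {w : P.suppB → ℝ}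
    (hw : ∀ b, 0 ≤ w b)
    (hagree : 0 ≤ ∑ b : P.suppB, w b * (if preferred b = preferred a then 1 else -1))
    (m : ℕ) (h : History) :
    ∑ b, w b * value a σ (bobSelfish P) a b m h ≤
      ∑ b : P.suppB, w b * ((h.length + m : ℕ) / 2 + |(a : ℝ) - 1 / 2| * (balance (preferred a) h +
        if preferred b = preferred a then (m : ℝ) else if m = 0 then 0 else -1)) := by
  have hd := abs_nonneg ((a : ℝ) - 1 / 2)
  induction m generalizing h with
  | zero => simp [value, totalGain_eq]
  | succ m ih =>
    have h0 := (σ a h).2.1 .risky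
    have h1 := sub_nonneg.2 (lottery_le_one (σ a h) .risky)
    set R : P.suppB → ℝ := fun b => (h.length + (m + 1) : ℕ) / 2 +
      |(a : ℝ) - 1 / 2| * (balance (preferred a) h +
        if preferred b = preferred a then ((m + 1 : ℕ) : ℝ) else if m + 1 = 0 then 0 else -1) with hR
    have hsafe : ∑ b, w b * value a σ (bobSelfish P) a b m (.nonrisky :: h) ≤
        ∑ b, w b * R b := by
      refine (ih (.nonrisky :: h)).trans ?_
      rw [← sub_nonneg, ← Finset.sum_sub_distrib]
      refine (mul_nonneg hd hagree).trans ?_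
      rw [Finset.mul_sum]
      refine Finset.sum_le_sum fun b _ => ?_
      have hwd := mul_nonneg (hw b) hd
      simp only [hR, List.length_cons, balance_nonrisky]
      push_cast
      by_cases hb : preferred b = preferred a
      · simp only [hb, if_true]
        linarith
      · simp only [hb, if_false]
        split_ifs <;> linarith
    have hrisk : ∑ b, w b * value a σ (bobSelfish P) a b m (.risky (preferred b) :: h) ≤
        ∑ b, w b * R b := by
      refine Finset.sum_le_sum fun b _ => mul_le_mul_of_nonneg_left ?_ (hw b)
      by_cases hb : preferred b = preferred a
      · refine (alice_value_le_of_agree σ a hb m _).trans (le_of_eq ?_)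
        simp only [hR, hb, if_true, List.length_cons, balance_self]
        push_cast
        ring
      · refine (alice_value_le_of_disagree σ a hb m _).trans (le_of_eq ?_)
        rw [Piece.eq_other_of_ne hb]
        simp only [hR, hb, if_false, List.length_cons, balance_other, Nat.succ_ne_zero]
        push_cast
        ring
    calc ∑ b, w b * value a σ (bobSelfish P) a b (m + 1) h
        = (1 - (σ a h).1 .risky) *
            (∑ b, w b * value a σ (bobSelfish P) a b m (.nonrisky :: h)) +
          (σ a h).1 .risky *
            ∑ b, w b * value a σ (bobSelfish P) a b m (.risky (preferred b) :: h) := by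
          rw [Finset.mul_sum, Finset.mul_sum, ← Finset.sum_add_distrib]
          refine Finset.sum_congr rfl fun b _ => ?_
          rw [value_succ, valueAfterRisk_selfish]
          ring
      _ ≤ (1 - (σ a h).1 .risky) * (∑ b, w b * R b) + (σ a h).1 .risky * ∑ b, w b * R b := by
          gcongr
      _ = ∑ b, w b * R b := by ring

lemma alice_counting_value {a : P.suppA} (ha : (a : ℝ) ≠ 1 / 2) (b : P.suppB) (m : ℕ)
    (h : History) :
    value a (aliceCounting P) (bobSelfish P) a b m h = (h.length + m : ℕ) / 2 +
      |(a : ℝ) - 1 / 2| * drift (riskProb 0) (if preferred b = preferred a then 1 else 0) m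
        (balance (preferred a) h) := by
  rw [← aliceTremble_zero, ← bobTremble_zero,
    value_eq_drift (aliceTremble_risky 0 ha) (bobTremble_success 0 (preferred a) b)]
  simp [successProb]

/-- At nonzero balance the weights single out one case, and counting attains its upper bound: stop
if negative, always risk if positive. At balance 0 it attains `alice_sum_value_le`. -/
lemma alice_weighted_value_le {a : P.suppA} (ha : (a : ℝ) ≠ 1 / 2) (hF : FavorsRisk a)
    (σ : AliceStrategy P) (m : ℕ) (h : History) :
    ∑ b, weight 0 a h b * value a σ (bobSelfish P) a b m h ≤
      ∑ b, weight 0 a h b * value a (aliceCounting P) (bobSelfish P) a b m h := by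
  have hy := balance_eq ha h
  rcases lt_trichotomy (balance (preferred a) h) 0 with hneg | hzero | hpos
  · refine Finset.sum_le_sum fun b _ => ?_
    by_cases hb : preferred b = preferred a
    · have : ¬ failures a h ≤ successes a h := by omega
      simp [weight_zero, hb, this]
    · refine mul_le_mul_of_nonneg_left ?_ (weight_zero_nonneg a h b)
      rw [alice_counting_value ha, drift_of_neg _ m hneg]
      exact alice_value_le_of_disagree σ a hb m h
  · have h1 : failures a h ≤ successes a h := by omega
    have h2 : successes a h ≤ failures a h := by omega
    refine (alice_sum_value_le σ a (weight_zero_nonneg a h) ?_ m h).trans (le_of_eq ?_)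
    · refine (sub_pos.2 hF.2).le.trans (le_of_eq ?_)
      rw [← Finset.sum_sub_distrib]
      refine Finset.sum_congr rfl fun b _ => ?_
      rw [weight_zero]
      by_cases hb : preferred b = preferred a <;> simp [hb, h1, h2]
    · refine Finset.sum_congr rfl fun b _ => ?_
      rw [alice_counting_value ha, hzero]
      by_cases hb : preferred b = preferred a
      · simp only [hb, if_true]
        rw [drift_of_nonneg m le_rfl]
      · simp only [hb, if_false]
        rw [drift_zero_zero]
        simp
  · refine Finset.sum_le_sum fun b _ => ?_
    by_cases hb : preferred b = preferred a
    · refine mul_le_mul_of_nonneg_left ?_ (weight_zero_nonneg a h b)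
      rw [alice_counting_value ha, if_pos hb, drift_of_nonneg m hpos.le]
      exact alice_value_le_of_agree σ a hb m h
    · have : ¬ successes a h ≤ failures a h := by omega
      simp [weight_zero, hb, this]

theorem isNash_counting_selfish (hA : ∀ a : P.suppA, (a : ℝ) ≠ 1 / 2)
    (hF : ∀ a : P.suppA, FavorsRisk a) (n : ℕ) :
    IsNash n (aliceCounting P) (bobSelfish P) := by
  refine ⟨fun σ => Finset.sum_le_sum fun a _ => ?_, fun τ => Finset.sum_le_sum fun a _ =>
    Finset.sum_le_sum fun b _ =>
      mul_le_mul_of_nonneg_left (bob_value_le (hA a) b τ n []) (P.p_nonneg a b)⟩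
  -- At the empty history the limit weights are the prior itself.
  have := alice_weighted_value_le (hA a) (hF a) σ n []
  simpa [weight_zero, successes, failures] using this

/-! ### Beliefs -/

/-- The distribution proportional to given weights. -/
noncomputable def normalize {α : Type} [Fintype α] (w : α → ℝ) (hw : ∀ x, 0 ≤ w x)
    (hs : 0 < ∑ x, w x) : Lottery α :=
  ⟨fun x => w x / ∑ y, w y, fun x => div_nonneg (hw x) hs.le, by
    rw [← Finset.sum_div, div_self hs.ne']⟩

lemma aliceBayes_tremble {e : unitInterval} (h0 : 0 < (e : ℝ)) (h1 : (e : ℝ) < 1) {a : P.suppA}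
    (ha : (a : ℝ) ≠ 1 / 2) (h : History) (b : P.suppB) :
    aliceBayes (aliceTremble P e) (bobTremble P e) a h b =
      weight e a h b / ∑ b', weight e a h b' := by
  obtain ⟨C, hC, hreach⟩ := exists_reachProb_eq h0 h1 ha h
  simp only [aliceBayes, hreach, ← Finset.mul_sum]
  exact mul_div_mul_left _ _ hC.ne'

lemma reachProb_pos {σ : AliceStrategy P} {τ : BobStrategy P} (a : P.suppA) (b : P.suppB)
    (hm : ∀ n, CompletelyMixed n σ τ) (h : History) : 0 < reachProb σ τ a b h := by
  induction h with
  | nil => exact zero_lt_one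
  | cons o h ih =>
    refine mul_pos ih ?_
    have hA := (hm _).1 a h (Nat.lt_succ_self _)
    have hB := (hm _).2 b h (Nat.lt_succ_self _)
    rcases o with _ | c
    · exact hA _
    · exact mul_pos (hA _) (hB _)

/-- Beliefs are defined at histories of every length, hence mixing for all `n`; `margB_pos` keeps
the denominators positive. -/
lemma exists_bobBelief_eq_bayes {σ : AliceStrategy P} {τ : BobStrategy P}
    (hm : ∀ n, CompletelyMixed n σ τ) :
    ∃ μ : BobBelief P, ∀ b h a, (μ b h).1 a = bobBayes σ τ b h a := by
  have hpos : ∀ (b : P.suppB) (h : History) (a : P.suppA),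
      0 < reachProb σ τ a b h * (σ a h).1 .risky := fun b h a =>
    mul_pos (reachProb_pos a b hm h) ((hm _).1 a h (Nat.lt_succ_self _) _)
  have hnonneg : ∀ (b : P.suppB) (h : History) (a : P.suppA),
      0 ≤ P.p a b * (reachProb σ τ a b h * (σ a h).1 .risky) := fun b h a =>
    mul_nonneg (P.p_nonneg a b) (hpos b h a).le
  refine ⟨fun b h => normalize _ (hnonneg b h) ?_, fun b h a => rfl⟩
  obtain ⟨a, _, ha⟩ : ∃ a ∈ Finset.univ, 0 < P.p a b := by
    by_contra! hcon
    exact (Finset.sum_nonpos hcon).not_gt (P.margB_pos b)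
  exact Finset.sum_pos' (fun a _ => hnonneg b h a) ⟨a, Finset.mem_univ _, mul_pos ha (hpos b h a)⟩

theorem isSequentialEquilibrium_counting_selfish (hA : ∀ a : P.suppA, (a : ℝ) ≠ 1 / 2)
    (hF : ∀ a : P.suppA, FavorsRisk a) (n : ℕ) :
    IsSequentialEquilibrium n (aliceCounting P) (bobSelfish P) := by
  obtain ⟨es, hes, hlim⟩ := exists_mistake_seq
  have hmixed : ∀ i n, CompletelyMixed n (aliceTremble P (es i)) (bobTremble P (es i)) :=
    fun i n => completelyMixed_tremble n (hes i).1 (hes i).2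
  choose μs hμs using fun i => exists_bobBelief_eq_bayes (hmixed i)
  -- The space of Bob's beliefs is a countable product of simplices, so a subsequence of the
  -- Bayesian beliefs converges. The limit need not be identified, because Bob's strategy is optimal
  -- under any belief.
  obtain ⟨μB, φ, hφ, hμB⟩ := CompactSpace.tendsto_subseq μs
  have hlimφ := hlim.comp hφ.tendsto_atTop
  have hlim' : Tendsto (fun i => (es (φ i) : ℝ)) atTop (𝓝 0) := by
    simpa using tendsto_subtype_rng.1 hlimφ
  refine ⟨fun a h => normalize (weight 0 a h) (weight_zero_nonneg a h)
    (sum_weight_zero_pos (hF a) h), μB, ⟨fun i => aliceTremble P (es (φ i)),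
    fun i => bobTremble P (es (φ i)), fun i => hmixed _ n, convergesTo_tremble n hlimφ, ?_, ?_⟩,
    ?_, ?_⟩
  · intro a h _ b
    simp only [aliceBayes_tremble (hes _).1 (hes _).2 (hA a)]
    have hw : ∀ b, Tendsto (fun i => weight (es (φ i) : ℝ) a h b) atTop (𝓝 (weight 0 a h b)) :=
      fun b => ((continuous_weight a h b).tendsto 0).comp hlim'
    exact (hw b).div (tendsto_finsetSum _ fun b _ => hw b) (sum_weight_zero_pos (hF a) h).ne'
  · intro b h _ a
    simp only [← hμs]
    have hc : Continuous fun μ : BobBelief P => (μ b h).1 a :=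
      (continuous_apply a).comp
        (continuous_subtype_val.comp (continuous_apply_apply (ρ := fun _ _ => Lottery P.suppA) b h))
    exact (hc.tendsto μB).comp hμB
  · intro a h _ σ
    have hle := div_le_div_of_nonneg_right (alice_weighted_value_le (hA a) (hF a) σ (n - h.length) h)
      (sum_weight_zero_pos (hF a) h).le
    simpa only [normalize, Finset.sum_div, div_mul_eq_mul_div] using hle
  · intro b h _ τ
    exact Finset.sum_le_sum fun a _ => mul_le_mul_of_nonneg_left
      (bob_valueAfterRisk_le (hA a) b τ _ h) ((μB b h).2.1 a)

end DivideChoose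

theorem mainTheorem2 (P : DivideChoose.Prior) (n : ℕ) (hn : 1 ≤ n)
    (hA : ∀ a : P.suppA, (a : ℝ) ≠ 1 / 2)
    (hB : ∀ b : P.suppB, (b : ℝ) ≠ 1 / 2)
    (hT : ∀ a : P.suppA, P.condT 0 a ≠ 0 ∧ P.condT 1 a ≠ 0)
    (hRisk : ∀ a : P.suppA,
      P.condT 0 a * min (a : ℝ) (1 - a) + P.condT 1 a * max (a : ℝ) (1 - a) > 1 / 2) :
    DivideChoose.IsNash n (DivideChoose.aliceCounting P) (DivideChoose.bobSelfish P) ∧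
    DivideChoose.IsTHP n (DivideChoose.aliceCounting P) (DivideChoose.bobSelfish P) ∧
    DivideChoose.IsSequentialEquilibrium n (DivideChoose.aliceCounting P)
      (DivideChoose.bobSelfish P) := by
  have hF : ∀ a : P.suppA, DivideChoose.FavorsRisk a := fun a =>
    ⟨DivideChoose.disagree_pos (hA a) hB (hT a).1,
      DivideChoose.disagree_lt_agree (hA a) hB (hRisk a)⟩
  exact ⟨DivideChoose.isNash_counting_selfish hA hF n,
    DivideChoose.isTHP_counting_selfish hA hF n,
    DivideChoose.isSequentialEquilibrium_counting_selfish hA hF n⟩
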